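/- There is a universal constant $L>0$ such that the following holds with $K_c=(Lc)^c$. Let $c,d,k\ge 1$ be integers and let $\Sigma=[2^k]$, identified with the group $(\mathbb Z/2\mathbb Z)^k$ (bitwise XOR $\oplus$). A uniformly random table with values in a finite set $R$ is a family of independent random variables, each uniformly distributed on $R$. A simple tabulation hash function $h_2\colon\Sigma^c\to\Sigma^d$ is a random function $h_2(\alpha_0,\dots,\alpha_{c-1})=\bigoplus_{i=0}^{c-1}T(i,\alpha_i)$ with $T\colon\{0,\dots,c-1\}\times\Sigma\to\Sigma^d$ a uniformly random table. A simple tabulation sign function $\Sigma^n\to\{-1,1\}$ is a random function $(\alpha_0,\dots,\alpha_{n-1})\mapsto\prod_{i=0}^{n-1}T(i,\alpha_i)$ with $T\colon\{0,\dots,n-1\}\times\Sigma\to\{-1,1\}$ a uniformly random table. A mixed tabulation sign function with $d$ derived characters is a random function $\varepsilon\colon\Sigma^c\to\{-1,1\}$ of the form $\varepsilon(x)=\varepsilon_1(x)\,\varepsilon_3(h_2(x))$, where $\varepsilon_1\colon\Sigma^c\to\{-1,1\}$ and $\varepsilon_3\colon\Sigma^d\to\{-1,1\}$ are simple tabulation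 sign functions, $h_2\colon\Sigma^c\to\Sigma^d$ is a simple tabulation hash function, and $\varepsilon_1,h_2,\varepsilon_3$ are mutually independent. Then for every mixed tabulation sign function $\varepsilon\colon\Sigma^c\to\{-1,1\}$ with $d$ derived characters, every weight function $w\colon\Sigma^c\to\mathbb R$ and every real $p\ge 2$, $$\Big\|\sum_{x\in\Sigma^c}w(x)\varepsilon(x)\Big\|_p\le\sqrt e\,K_c\,\sqrt p\,\gamma_p^{c/2}\sqrt{\sum_{x\in\Sigma^c}w(x)^2},\qquad \gamma_p=\max\Big\{1,\frac{p}{\log|\Sigma|}\Big\},$$ where $\|X\|_p=\mathbb E[|X|^p]^{1/p}$. -/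

import Mathlib

open MeasureTheory ProbabilityTheory

/-- The alphabet `Σ = [2 ^ k]`, i.e. the bit strings of length `k`, identified with the abelian group
`(ℤ / 2ℤ) ^ k`; bitwise XOR is the addition of this group. -/
abbrev Alphabet (k : ℕ) : Type := Fin k → ZMod 2

/-- The keys `Σ ^ c`: strings of `c` characters of the alphabet `A`. -/
abbrev Key (c : ℕ) (A : Type) : Type := Fin c → A

/-- The `σ`-algebra on the set of signs `{-1, 1} = ℤˣ` is the discrete one. -/
instance instMeasurableSingletonClassSign : MeasurableSingletonClass ℤˣ :=
  ⟨fun u => ⟨{(u : ℤ)}, MeasurableSet.singleton _, by ext v; simp [Units.ext_iff]⟩⟩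

/-- `T : {0, …, c - 1} × A → R` is a uniformly random table: its entries are independent and each
of them is uniformly distributed on the finite set `R`. -/
structure IsUniformTable {Ω : Type*} [MeasurableSpace Ω] (μ : Measure Ω) {c : ℕ} {A R : Type}
    [MeasurableSpace R] (T : Fin c × A → Ω → R) : Prop where
  uniform : ∀ q : Fin c × A, HasLaw (T q) (uniformOn Set.univ) μ
  indep : iIndepFun T μ

/-- The random function `h : A ^ c → R` is a simple tabulation hash function with `c` characters:
`h (α₀, …, α_{c-1}) = ⊕ᵢ T (i, αᵢ)` for a uniformly random table `T`, where `⊕` is the addition of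
the finite abelian group `R` (bitwise XOR if `R` consists of (tuples of) bit strings). -/
def IsSimpleTabulation {Ω : Type*} [MeasurableSpace Ω] (μ : Measure Ω) {c : ℕ} {A R : Type}
    [MeasurableSpace R] [AddCommMonoid R] (h : Ω → Key c A → R) : Prop :=
  ∃ T : Fin c × A → Ω → R, IsUniformTable μ T ∧ ∀ ω x, h ω x = ∑ i, T (i, x i) ω

/-- The random function `ε : A ^ c → {-1, 1}` is a simple tabulation sign function:
`ε (α₀, …, α_{c-1}) = ∏ᵢ T (i, αᵢ)` for a uniformly random table `T` of signs. -/
def IsSimpleTabulationSign {Ω : Type*} [MeasurableSpace Ω] (μ : Measure Ω) {c : ℕ} {A : Type}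
    (ε : Ω → Key c A → ℤˣ) : Prop :=
  ∃ T : Fin c × A → Ω → ℤˣ, IsUniformTable μ T ∧ ∀ ω x, ε ω x = ∏ i, T (i, x i) ω

/-- The random function `ε : Σ ^ c → {-1, 1}`, with `Σ = [2 ^ k]`, is a mixed tabulation sign
function with `d` derived characters: `ε x = ε₁ x * ε₃ (h₂ x)`, where the simple tabulation sign
functions `ε₁` on `Σ ^ c` and `ε₃` on `Σ ^ d` and the simple tabulation hash function
`h₂ : Σ ^ c → Σ ^ d` are (mutually) independent. -/
def IsMixedTabulationSign {Ω : Type*} [MeasurableSpace Ω] (μ : Measure Ω) {c k : ℕ} (d : ℕ)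
    (ε : Ω → Key c (Alphabet k) → ℤˣ) : Prop :=
  ∃ (ε₁ : Ω → Key c (Alphabet k) → ℤˣ)
    (h₂ : Ω → Key c (Alphabet k) → Key d (Alphabet k))
    (ε₃ : Ω → Key d (Alphabet k) → ℤˣ),
    IsSimpleTabulationSign μ ε₁ ∧ IsSimpleTabulation μ h₂ ∧ IsSimpleTabulationSign μ ε₃ ∧
    IndepFun ε₁ h₂ μ ∧ IndepFun (fun ω => (ε₁ ω, h₂ ω)) ε₃ μ ∧
    ∀ ω x, ε ω x = ε₁ ω x * ε₃ ω (h₂ ω x)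

/-- The `p`-norm `E[|X| ^ p] ^ (1 / p)` of a real random variable with `E[|X| ^ p] < ∞`. -/
noncomputable def pNorm {Ω : Type*} [MeasurableSpace Ω] (μ : Measure Ω) (X : Ω → ℝ) (p : ℝ) : ℝ :=
  (∫ ω, |X ω| ^ p ∂μ) ^ (1 / p)

/-- `γ_p = max {1, p / log |Σ|}`, as a function of `s = |Σ|`. -/
noncomputable def gammaFactor (s : ℕ) (p : ℝ) : ℝ := max 1 (p / Real.log s)

open scoped BigOperators

/-! The `p`-norm is bounded by an even moment of order `2nm`, with `p ≤ 2nm ≤ 4p`. All derived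
characters but one are conditioned on: their signs go into `w` without changing its squares. For the
remaining one, Khintchine in its sign table reduces the problem to the sum of squared bucket sums.
By Parseval on the alphabet this is the average over characters `χ` of `P_χ ^ 2`, where `P_χ` is the
degree-`c` Rademacher chaos at the sign table twisted by `χ` of the hash table.

Hypercontractivity for a single `P_χ` at order `p` would lose `p ^ c`. The gain comes from
independence: for linearly independent `χ`, the `P_χ` are independent (`expect_prod_twist`). The
`n`-th power of the average over `χ` is an average over `n`-tuples of characters, and a random tuple
is independent outside a set `D` that is usually small (`exists_dependent_set`). Off `D` only chaos
moments of order `4m` enter, at cost `(4em) ^ c` per factor; each member of `D` costs at most a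
further `n ^ c`, and averaging over tuples turns this into `1 + n ^ c 2 ^ (n - 1) / 2 ^ k`.

With `2n ≤ k + 1` that factor is bounded in terms of `c` alone, while `m` can be taken of order
`γ_p`; this yields `γ_p ^ (c / 2)` after the square root. -/

/-! ### Moment inequalities for finite averages -/

/-- Minkowski's inequality for the `N`-th moments of two nonnegative functions. -/
theorem expect_add_pow_le {Z : Type*} [Fintype Z] {f g : Z → ℝ} {a b : ℝ} {N : ℕ} (hN : N ≠ 0)
    (hf : ∀ z, 0 ≤ f z) (hg : ∀ z, 0 ≤ g z) (ha : 0 ≤ a) (hb : 0 ≤ b)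
    (hfa : 𝔼 z, f z ^ N ≤ a ^ N) (hgb : 𝔼 z, g z ^ N ≤ b ^ N) :
    𝔼 z, (f z + g z) ^ N ≤ (a + b) ^ N := by
  have zero : ∀ {h : Z → ℝ}, (∀ z, 0 ≤ h z) → 𝔼 z, h z ^ N ≤ 0 → ∀ z, h z = 0 := by
    intro h hh h0 z
    have h1 : 𝔼 z, h z ^ N = 0 :=
      le_antisymm h0 (Finset.expect_nonneg fun z _ => pow_nonneg (hh z) N)
    have h2 := (Fintype.expect_eq_zero_iff_of_nonneg
      (f := fun z => h z ^ N) fun z => pow_nonneg (hh z) N).1 h1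
    exact pow_eq_zero_iff hN |>.1 (congrFun h2 z)
  rcases ha.eq_or_lt with rfl | ha'
  · rw [zero_pow hN] at hfa
    simpa [zero hf hfa] using hgb
  rcases hb.eq_or_lt with rfl | hb'
  · rw [zero_pow hN] at hgb
    simpa [zero hg hgb] using hfa
  have hab : 0 < a + b := by positivity
  -- `(f + g) / (a + b)` is a convex combination of `f / a` and `g / b`, so convexity of the power
  -- applies.
  have key : ∀ z, (f z + g z) ^ N ≤
      (a + b) ^ N * (a / (a + b) * (f z ^ N / a ^ N) + b / (a + b) * (g z ^ N / b ^ N)) := by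
    intro z
    have h := (convexOn_pow N).2 (Set.mem_Ici.2 (div_nonneg (hf z) ha))
      (Set.mem_Ici.2 (div_nonneg (hg z) hb)) (by positivity : 0 ≤ a / (a + b))
      (by positivity : 0 ≤ b / (a + b)) (by field_simp)
    simp only [smul_eq_mul, div_pow] at h
    calc (f z + g z) ^ N
        = (a + b) ^ N * (a / (a + b) * (f z / a) + b / (a + b) * (g z / b)) ^ N := by
          rw [← mul_pow]; congr 1; field_simp
      _ ≤ _ := by gcongr
  calc 𝔼 z, (f z + g z) ^ N
      ≤ 𝔼 z, (a + b) ^ N * (a / (a + b) * (f z ^ N / a ^ N) + b / (a + b) * (g z ^ N / b ^ N)) :=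
        Finset.expect_le_expect fun z _ => key z
    _ = (a + b) ^ N * (a / (a + b) * ((𝔼 z, f z ^ N) / a ^ N) +
          b / (a + b) * ((𝔼 z, g z ^ N) / b ^ N)) := by
        rw [← Finset.mul_expect, Finset.expect_add_distrib, ← Finset.mul_expect,
          ← Finset.mul_expect, Finset.expect_div, Finset.expect_div]
    _ ≤ (a + b) ^ N * (a / (a + b) * 1 + b / (a + b) * 1) := by
        gcongr
        · exact div_le_one_of_le₀ hfa (by positivity)
        · exact div_le_one_of_le₀ hgb (by positivity)
    _ = (a + b) ^ N := by field_simp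

/-- Minkowski's inequality for the `N`-th moments of a sum of nonnegative functions. -/
theorem expect_sum_pow_le {Z ι : Type*} [Fintype Z] (s : Finset ι) {f : ι → Z → ℝ} {b : ι → ℝ}
    {N : ℕ} (hN : N ≠ 0) (hf : ∀ i z, 0 ≤ f i z) (hb : ∀ i, 0 ≤ b i)
    (h : ∀ i, 𝔼 z, f i z ^ N ≤ b i ^ N) :
    𝔼 z, (∑ i ∈ s, f i z) ^ N ≤ (∑ i ∈ s, b i) ^ N := by
  classical
  induction s using Finset.induction_on with
  | empty => simp [hN]
  | insert i s hi ih =>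
    simp only [Finset.sum_insert hi]
    exact expect_add_pow_le hN (hf i) (fun z => Finset.sum_nonneg fun j _ => hf j z) (hb i)
      (Finset.sum_nonneg fun j _ => hb j) (h i) ih

/-- Minkowski's inequality for the `N`-th moments of an average of nonnegative functions. -/
theorem expect_expect_pow_le {Z ι : Type*} [Fintype Z] [Fintype ι] {f : ι → Z → ℝ} {b : ι → ℝ}
    {N : ℕ} (hN : N ≠ 0) (hf : ∀ i z, 0 ≤ f i z) (hb : ∀ i, 0 ≤ b i)
    (h : ∀ i, 𝔼 z, f i z ^ N ≤ b i ^ N) :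
    𝔼 z, (𝔼 i, f i z) ^ N ≤ (𝔼 i, b i) ^ N := by
  simp only [Fintype.expect_eq_sum_div_card (ι := ι), div_pow]
  rw [← Finset.expect_div]
  gcongr
  exact expect_sum_pow_le _ hN hf hb h

/-- A homomorphism onto a finite group preserves uniform averages. -/
theorem expect_comp_of_surjective {G H : Type*} [Fintype G] [Fintype H] [AddGroup G] [Group H]
    (φ : G → H) (hφ : ∀ x y, φ (x + y) = φ x * φ y) (hs : Function.Surjective φ) (f : H → ℝ) :
    𝔼 x, f (φ x) = 𝔼 y, f y := by
  -- The double average of `f (φ x * y)` is computed twice: translating in `G` removes `y`,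
  -- translating in `H` removes `x`. No fibres need counting.
  have h1 : ∀ y : H, 𝔼 x, f (φ x * y) = 𝔼 x, f (φ x) := by
    intro y
    obtain ⟨g, rfl⟩ := hs y
    exact Fintype.expect_equiv (Equiv.addRight g) _ _ fun x => by simp [hφ]
  have h2 : ∀ x : G, 𝔼 y, f (φ x * y) = 𝔼 y, f y := fun x =>
    Fintype.expect_equiv (Equiv.mulLeft (φ x)) _ _ fun y => by simp
  calc 𝔼 x, f (φ x) = 𝔼 _y : H, 𝔼 x, f (φ x) := (Fintype.expect_const _).symm
    _ = 𝔼 y : H, 𝔼 x, f (φ x * y) := by simp only [h1]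
    _ = 𝔼 x, 𝔼 y, f (φ x * y) := Finset.expect_comm _ _ _
    _ = 𝔼 y, f y := by simp only [h2]; exact Fintype.expect_const _

/-- The average of a product of functions of independent uniform variables. -/
theorem expect_prod_eq_prod_expect {I S : Type*} [Fintype I] [DecidableEq I] [Fintype S]
    (f : I → S → ℝ) : 𝔼 η : I → S, ∏ i, f i (η i) = ∏ i, 𝔼 s, f i s := by
  simp only [Fintype.expect_eq_sum_div_card, Finset.prod_div_distrib, Finset.prod_const,
    Fintype.card_fun, Finset.card_univ, Nat.cast_pow]
  rw [Finset.prod_univ_sum, Fintype.piFinset_univ]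

/-- A product of nonnegative functions is controlled by their moments. -/
theorem expect_prod_le_of_moment {Z ι : Type*} [Fintype Z] (s : Finset ι)
    {f : ι → Z → ℝ} {B : ℝ} (hs : s.Nonempty) (hf : ∀ i z, 0 ≤ f i z)
    (h : ∀ i, 𝔼 z, f i z ^ s.card ≤ B) : 𝔼 z, ∏ i ∈ s, f i z ≤ B := by
  have hc : (0 : ℝ) < s.card := by exact_mod_cast hs.card_pos
  -- AM-GM: the product is the geometric mean of the powers of order `s.card`.
  have key : ∀ z, ∏ i ∈ s, f i z ≤ ∑ i ∈ s, (s.card : ℝ)⁻¹ * f i z ^ s.card := by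
    intro z
    have h1 := Real.geom_mean_le_arith_mean_weighted s (fun _ => (s.card : ℝ)⁻¹)
      (fun i => f i z ^ s.card) (fun _ _ => by positivity)
      (by simp; field_simp) (fun i _ => pow_nonneg (hf i z) _)
    refine le_trans (le_of_eq ?_) h1
    refine Finset.prod_congr rfl fun i _ => ?_
    rw [Real.pow_rpow_inv_natCast (hf i z) hs.card_pos.ne']
  calc 𝔼 z, ∏ i ∈ s, f i z ≤ 𝔼 z, ∑ i ∈ s, (s.card : ℝ)⁻¹ * f i z ^ s.card :=
        Finset.expect_le_expect fun z _ => key z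
    _ = ∑ i ∈ s, (s.card : ℝ)⁻¹ * 𝔼 z, f i z ^ s.card := by
        rw [Finset.expect_sum_comm]; simp only [Finset.mul_expect]
    _ ≤ ∑ i ∈ s, (s.card : ℝ)⁻¹ * B := by gcongr with i; exact h i
    _ = B := by simp; field_simp

/-! ### Khintchine's inequality and decoupled Rademacher chaoses -/

/-- Khintchine's inequality for even moments. -/
theorem khintchine {ι : Type*} [Fintype ι] [DecidableEq ι] (a : ι → ℝ) (N : ℕ) :
    𝔼 t : ι → ℤˣ, (∑ i, ((t i : ℤ) : ℝ) * a i) ^ (2 * N) ≤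
      (2 * Real.exp 1 * N) ^ N * (∑ i, a i ^ 2) ^ N := by
  rcases Nat.eq_zero_or_pos N with rfl | hN
  · simp
  set σ := ∑ i, a i ^ 2 with hσ
  have hσ0 : 0 ≤ σ := Finset.sum_nonneg fun i _ => sq_nonneg _
  rcases hσ0.eq_or_lt with h0 | h0
  · have ha : ∀ i, a i = 0 := by
      intro i
      have := (Finset.sum_eq_zero_iff_of_nonneg fun i _ => sq_nonneg (a i)).1 (hσ.symm.trans h0.symm)
        i (Finset.mem_univ i)
      simpa using this
    simp only [ha, mul_zero, Finset.sum_const_zero]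
    rw [zero_pow (by omega), Fintype.expect_const]
    positivity
  have hNr : (0 : ℝ) < N := by exact_mod_cast hN
  -- This `l` minimises `exp (l² σ / 2) / l ^ (2N)`.
  set l := √(2 * N / σ) with hl
  have hl2 : l ^ 2 = 2 * N / σ := Real.sq_sqrt (by positivity)
  have hlpos : 0 < l := Real.sqrt_pos.2 (by positivity)
  have mgf : 𝔼 t : ι → ℤˣ, Real.exp (l * ∑ i, ((t i : ℤ) : ℝ) * a i) ≤ Real.exp N := by
    have h1 : ∀ t : ι → ℤˣ, Real.exp (l * ∑ i, ((t i : ℤ) : ℝ) * a i) =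
        ∏ i, Real.exp (l * (((t i : ℤ) : ℝ) * a i)) := by
      intro t; rw [Finset.mul_sum, Real.exp_sum]
    simp only [h1]
    rw [expect_prod_eq_prod_expect (fun i (u : ℤˣ) => Real.exp (l * (((u : ℤ) : ℝ) * a i)))]
    have h2 : ∀ i, 𝔼 u : ℤˣ, Real.exp (l * (((u : ℤ) : ℝ) * a i)) = Real.cosh (l * a i) := by
      intro i
      rw [Fintype.expect_eq_sum_div_card, Real.cosh_eq]
      simp [UnitsInt.univ]
    simp only [h2]
    calc ∏ i, Real.cosh (l * a i) ≤ ∏ i, Real.exp ((l * a i) ^ 2 / 2) :=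
          Finset.prod_le_prod (fun i _ => (Real.cosh_pos _).le)
            fun i _ => Real.cosh_le_exp_half_sq _
      _ = Real.exp (l ^ 2 / 2 * σ) := by
          rw [← Real.exp_sum, hσ, Finset.mul_sum]
          congr 1; exact Finset.sum_congr rfl fun i _ => by ring
      _ = Real.exp N := by rw [hl2]; congr 1; field_simp
  have mgf' : 𝔼 t : ι → ℤˣ, Real.exp (-(l * ∑ i, ((t i : ℤ) : ℝ) * a i)) ≤ Real.exp N := by
    refine le_trans (le_of_eq ?_) mgf
    refine Fintype.expect_equiv (Equiv.neg (ι → ℤˣ)) _ _ fun t => ?_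
    simp
  -- A single term of the series of `cosh (l x)` is kept.
  have key : ∀ x : ℝ, x ^ (2 * N) ≤
      (2 * N).factorial / l ^ (2 * N) * ((Real.exp (l * x) + Real.exp (-(l * x))) / 2) := by
    intro x
    have h1 : (l * x) ^ (2 * N) / (2 * N).factorial ≤ Real.cosh (l * x) :=
      le_hasSum (Real.hasSum_cosh (l * x)) N fun j _ =>
        div_nonneg ((even_two_mul j).pow_nonneg _) (by positivity)
    rw [Real.cosh_eq, div_le_iff₀ (by positivity), mul_pow] at h1
    rw [div_mul_eq_mul_div, le_div_iff₀ (by positivity)]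
    linarith
  calc 𝔼 t : ι → ℤˣ, (∑ i, ((t i : ℤ) : ℝ) * a i) ^ (2 * N)
      ≤ 𝔼 t : ι → ℤˣ, (2 * N).factorial / l ^ (2 * N) *
          ((Real.exp (l * ∑ i, ((t i : ℤ) : ℝ) * a i) +
            Real.exp (-(l * ∑ i, ((t i : ℤ) : ℝ) * a i))) / 2) :=
        Finset.expect_le_expect fun t _ => key _
    _ = (2 * N).factorial / l ^ (2 * N) *
          ((𝔼 t : ι → ℤˣ, Real.exp (l * ∑ i, ((t i : ℤ) : ℝ) * a i) +
            𝔼 t : ι → ℤˣ, Real.exp (-(l * ∑ i, ((t i : ℤ) : ℝ) * a i))) / 2) := by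
        rw [← Finset.mul_expect, ← Finset.expect_div, Finset.expect_add_distrib]
    _ ≤ (2 * N : ℝ) ^ (2 * N) / l ^ (2 * N) * ((Real.exp N + Real.exp N) / 2) := by
        gcongr
        exact_mod_cast Nat.factorial_le_pow _
    _ = (2 * Real.exp 1 * N) ^ N * σ ^ N := by
        have : Real.exp N = Real.exp 1 ^ N := by rw [← Real.exp_nat_mul, mul_one]
        rw [this, pow_mul l, hl2, pow_mul, ← div_pow, add_self_div_two, ← mul_pow, ← mul_pow]
        congr 1; field_simp

/-- The decoupled Rademacher chaos with coefficients `w`, evaluated at a table `T` of signs. -/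
noncomputable def chaos {c : ℕ} {A : Type} [Fintype A] (w : Key c A → ℝ) (T : Fin c × A → ℤˣ) : ℝ :=
  ∑ x, w x * ((∏ i, T (i, x i) : ℤˣ) : ℤ)

/-- A table with `c + 1` rows consists of its first row and a table with `c` rows. -/
def tableConsEquiv (c : ℕ) (A R : Type) : (A → R) × (Fin c × A → R) ≃ (Fin (c + 1) × A → R) :=
  ((Equiv.refl _).prodCongr (Equiv.curry _ _ _)).trans
    ((Fin.consEquiv fun _ => A → R).trans (Equiv.curry _ _ _).symm)

@[simp] theorem tableConsEquiv_zero {c : ℕ} {A R : Type} (t : A → R) (T : Fin c × A → R) (a : A) :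
    tableConsEquiv c A R (t, T) (0, a) = t a := rfl

@[simp] theorem tableConsEquiv_succ {c : ℕ} {A R : Type} (t : A → R) (T : Fin c × A → R)
    (i : Fin c) (a : A) : tableConsEquiv c A R (t, T) (i.succ, a) = T (i, a) := rfl

theorem chaos_tableConsEquiv {c : ℕ} {A : Type} [Fintype A] (w : Key (c + 1) A → ℝ)
    (t : A → ℤˣ) (T : Fin c × A → ℤˣ) :
    chaos w (tableConsEquiv c A ℤˣ (t, T)) =
      ∑ a, ((t a : ℤ) : ℝ) * chaos (fun x : Key c A => w (Fin.cons a x)) T := by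
  unfold chaos
  rw [← (Fin.consEquiv fun _ : Fin (c + 1) => A).sum_comp, Fintype.sum_prod_type]
  refine Finset.sum_congr rfl fun a _ => ?_
  rw [Finset.mul_sum]
  refine Finset.sum_congr rfl fun x _ => ?_
  have hx : Fin.consEquiv (fun _ : Fin (c + 1) => A) (a, x) = Fin.cons a x := rfl
  simp only [hx, Fin.prod_univ_succ, Fin.cons_zero, Fin.cons_succ,
    tableConsEquiv_zero, tableConsEquiv_succ, Units.val_mul, Int.cast_mul]
  ring

/-- Hypercontractivity for decoupled Rademacher chaoses. -/
theorem expect_chaos_pow_le {c : ℕ} {A : Type} [Fintype A] [DecidableEq A] (w : Key c A → ℝ)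
    {N : ℕ} (hN : N ≠ 0) :
    𝔼 T, chaos w T ^ (2 * N) ≤ (2 * Real.exp 1 * N) ^ (c * N) * (∑ x, w x ^ 2) ^ N := by
  induction c with
  | zero =>
    have h : ∀ T : Fin 0 × A → ℤˣ, chaos w T ^ (2 * N) = (∑ x, w x ^ 2) ^ N := by
      simp [chaos, pow_mul]
    simp only [h, zero_mul, pow_zero, one_mul]
    rw [Fintype.expect_const]
  | succ c ih =>
    have khin := fun a : A → ℝ => khintchine a N
    have hC0 : 0 ≤ 2 * Real.exp 1 * (N : ℝ) := by positivity
    generalize 2 * Real.exp 1 * (N : ℝ) = C at ih khin hC0 ⊢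
    have hw : ∑ x : Key (c + 1) A, w x ^ 2 = ∑ a, ∑ x : Key c A, w (Fin.cons a x) ^ 2 := by
      rw [← (Fin.consEquiv fun _ : Fin (c + 1) => A).sum_comp, Fintype.sum_prod_type]
      rfl
    rw [← Fintype.expect_equiv (tableConsEquiv c A ℤˣ) _ _ fun _ => rfl,
      ← Finset.univ_product_univ, Finset.expect_product, Finset.expect_comm]
    simp only [chaos_tableConsEquiv]
    -- Khintchine in the first row, with the other rows fixed, costs `C ^ N`. Minkowski at exponent
    -- `N` for the squared smaller chaoses then lets the induction hypothesis be used for each first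
    -- character.
    calc 𝔼 T : Fin c × A → ℤˣ, 𝔼 t : A → ℤˣ,
          (∑ a, ((t a : ℤ) : ℝ) * chaos (fun x : Key c A => w (Fin.cons a x)) T) ^ (2 * N)
        ≤ 𝔼 T : Fin c × A → ℤˣ, C ^ N *
            (∑ a, chaos (fun x : Key c A => w (Fin.cons a x)) T ^ 2) ^ N :=
          Finset.expect_le_expect fun T _ => khin _
      _ ≤ C ^ N * (∑ a, C ^ c * ∑ x : Key c A, w (Fin.cons a x) ^ 2) ^ N := by
          rw [← Finset.mul_expect]
          gcongr
          refine expect_sum_pow_le _ hN (fun a T => sq_nonneg _)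
            (fun a => mul_nonneg (by positivity) (Finset.sum_nonneg fun x _ => sq_nonneg _)) ?_
          intro a
          simp only [← pow_mul, mul_pow]
          exact ih _
      _ = _ := by
          rw [← Finset.mul_sum, hw, mul_pow, ← mul_assoc, ← pow_mul, ← pow_add]
          congr 2; ring

/-! ### Characters of the alphabet -/

/-- The nontrivial character of `ZMod 2`. -/
def parity (z : ZMod 2) : ℤˣ := if z = 0 then 1 else -1

theorem parity_add : ∀ y z : ZMod 2, parity (y + z) = parity y * parity z := by decide

theorem parity_surjective : Function.Surjective parity := by decide

/-- The character `v ↦ (-1) ^ ⟨χ, v⟩` of the alphabet. -/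
def charSign {k : ℕ} (χ v : Alphabet k) : ℤˣ := parity (χ ⬝ᵥ v)

@[simp] theorem charSign_zero {k : ℕ} (χ : Alphabet k) : charSign χ 0 = 1 := by
  simp [charSign, parity]

theorem charSign_add {k : ℕ} (χ v v' : Alphabet k) :
    charSign χ (v + v') = charSign χ v * charSign χ v' := by
  simp [charSign, dotProduct_add, parity_add]

theorem charSign_add_left {k : ℕ} (χ χ' v : Alphabet k) :
    charSign (χ + χ') v = charSign χ v * charSign χ' v := by
  simp [charSign, add_dotProduct, parity_add]

theorem charSign_sum {k : ℕ} {ι : Type*} (s : Finset ι) (χ : Alphabet k) (v : ι → Alphabet k) :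
    charSign χ (∑ i ∈ s, v i) = ∏ i ∈ s, charSign χ (v i) := by
  classical
  induction s using Finset.induction_on with
  | empty => simp
  | insert i s hi ih => rw [Finset.sum_insert hi, Finset.prod_insert hi, charSign_add, ih]

/-- Orthogonality of characters. -/
theorem expect_charSign {k : ℕ} (v : Alphabet k) :
    𝔼 χ : Alphabet k, ((charSign χ v : ℤ) : ℝ) = if v = 0 then 1 else 0 := by
  split_ifs with hv
  · subst hv; simp
  -- Shifting `χ` by a basis vector where `v` is nonzero flips the sign, so the average equals its
  -- own negative.
  · obtain ⟨j, hj⟩ := Function.ne_iff.1 hv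
    have hflip : charSign (Pi.single j 1) v = -1 := by
      simpa [charSign, parity] using hj
    have h : 𝔼 χ : Alphabet k, ((charSign χ v : ℤ) : ℝ) =
        𝔼 χ : Alphabet k, -((charSign χ v : ℤ) : ℝ) := by
      refine Fintype.expect_equiv (Equiv.addRight (Pi.single j 1)) _ _ fun χ => ?_
      simp [charSign_add_left, hflip]
    rw [Finset.expect_neg_distrib] at h
    linarith

/-- Parseval's identity for the bucket sums of a hash function. -/
theorem sum_bucket_sq_eq_expect {k : ℕ} {X : Type*} [Fintype X] (u : X → ℝ) (h : X → Alphabet k) :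
    ∑ v, (∑ x, if h x = v then u x else 0) ^ 2 =
      𝔼 χ, (∑ x, u x * ((charSign χ (h x) : ℤ) : ℝ)) ^ 2 := by
  have hsub : ∀ v v' : Alphabet k, v + v' = 0 ↔ v = v' := fun v v' => by
    rw [add_eq_zero_iff_eq_neg, ZModModule.neg_eq_self]
  calc ∑ v, (∑ x, if h x = v then u x else 0) ^ 2
      = ∑ x, ∑ y, if h x = h y then u x * u y else 0 := by
        simp only [sq, Finset.sum_mul_sum]
        rw [Finset.sum_comm]
        refine Finset.sum_congr rfl fun x _ => ?_
        rw [Finset.sum_comm]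
        refine Finset.sum_congr rfl fun y _ => ?_
        simp only [ite_mul, zero_mul, Finset.sum_ite_eq, Finset.mem_univ, if_true]
        simp [eq_comm]
    _ = ∑ x, ∑ y, 𝔼 χ, u x * u y * ((charSign χ (h x + h y) : ℤ) : ℝ) := by
        simp only [← Finset.mul_expect, expect_charSign, hsub, mul_ite, mul_one, mul_zero]
    _ = 𝔼 χ, (∑ x, u x * ((charSign χ (h x) : ℤ) : ℝ)) ^ 2 := by
        simp only [sq, Finset.sum_mul_sum, Finset.expect_sum_comm]
        refine Finset.sum_congr rfl fun x _ => Finset.sum_congr rfl fun y _ =>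
          Finset.expect_congr rfl fun χ _ => ?_
        rw [charSign_add]; push_cast; ring

/-- Khintchine's inequality for signs that are read off at hash values. -/
theorem khintchine_hash {k : ℕ} {X : Type*} [Fintype X] (u : X → ℝ) (h : X → Alphabet k) (N : ℕ) :
    𝔼 t : Alphabet k → ℤˣ, (∑ x, u x * ((t (h x) : ℤ) : ℝ)) ^ (2 * N) ≤
      (2 * Real.exp 1 * N) ^ N *
        (𝔼 χ, (∑ x, u x * ((charSign χ (h x) : ℤ) : ℝ)) ^ 2) ^ N := by
  rw [← sum_bucket_sq_eq_expect]
  refine le_trans (le_of_eq ?_) (khintchine _ N)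
  refine Finset.expect_congr rfl fun t _ => ?_
  congr 1
  simp only [Finset.mul_sum]
  rw [Finset.sum_comm]
  refine Finset.sum_congr rfl fun x _ => ?_
  simp [mul_comm]

/-- Linearly independent characters take arbitrary simultaneous values. -/
theorem exists_charSign_eq {k : ℕ} {I : Type*} {χ : I → Alphabet k}
    (hχ : LinearIndependent (ZMod 2) χ) (η : I → ℤˣ) : ∃ v, ∀ i, charSign (χ i) v = η i := by
  choose z hz using fun i => parity_surjective (η i)
  -- Prescribe a functional on the span of the `χ i`, extend it to the whole space, and represent it
  -- by its values on the basis.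
  obtain ⟨f, hf⟩ := LinearMap.exists_extend
    ((Finsupp.linearCombination (ZMod 2) z).comp hχ.repr)
  refine ⟨fun j => f (Pi.single j 1), fun i => ?_⟩
  have h1 : f (χ i) = z i := by
    have := LinearMap.congr_fun hf ⟨χ i, Submodule.subset_span ⟨i, rfl⟩⟩
    simpa [hχ.repr_eq_single i ⟨χ i, Submodule.subset_span ⟨i, rfl⟩⟩ rfl] using this
  rw [charSign, ← hz i, ← h1, LinearMap.pi_apply_eq_sum_univ f (χ i)]
  congr 1
  simp only [dotProduct, smul_eq_mul]
  refine Finset.sum_congr rfl fun j _ => ?_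
  congr 2
  funext l
  simp [Pi.single_apply, eq_comm]

/-- The table `T` of signs multiplied by the character `χ` of the table `H` of hash values. -/
def twist {k : ℕ} {Q : Type} (T : Q → ℤˣ) (H : Q → Alphabet k) (χ : Alphabet k) : Q → ℤˣ :=
  fun q => T q * charSign χ (H q)

/-- The twists by linearly independent characters are independent and uniformly distributed. -/
theorem expect_prod_twist {k : ℕ} {Q : Type} [Fintype Q] [DecidableEq Q] {I : Type*} [Fintype I]
    [DecidableEq I] {χ : I → Alphabet k} (hχ : LinearIndependent (ZMod 2) χ) (T : Q → ℤˣ)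
    (g : (Q → ℤˣ) → ℝ) :
    𝔼 H : Q → Alphabet k, ∏ i, g (twist T H (χ i)) = ∏ _i : I, 𝔼 η, g η := by
  -- Linear independence makes `H ↦ (charSign (χ i) (H q))` a homomorphism onto all families of sign
  -- tables; the fixed `T` is then absorbed by translation.
  have h := expect_comp_of_surjective
    (fun (H : Q → Alphabet k) (i : I) (q : Q) => charSign (χ i) (H q))
    (fun H H' => by funext i q; simp [charSign_add])
    (fun η => by
      choose v hv using fun q => exists_charSign_eq hχ fun i => η i q
      exact ⟨v, by funext i q; exact hv q i⟩)
    (fun η : I → Q → ℤˣ => ∏ i, g (T * η i))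
  refine h.trans ?_
  rw [expect_prod_eq_prod_expect fun _ (η : Q → ℤˣ) => g (T * η)]
  refine Finset.prod_congr rfl fun i _ => ?_
  exact Fintype.expect_equiv (Equiv.mulLeft T) _ _ fun η => rfl

/-- A single twist is uniformly distributed. -/
theorem expect_twist {k : ℕ} {Q : Type} [Fintype Q] [DecidableEq Q] (χ : Alphabet k)
    (g : (Q → ℤˣ) → ℝ) :
    𝔼 z : (Q → ℤˣ) × (Q → Alphabet k), g (twist z.1 z.2 χ) = 𝔼 η, g η := by
  rw [← Finset.univ_product_univ, Finset.expect_product, Finset.expect_comm]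
  have h : ∀ H : Q → Alphabet k, 𝔼 T : Q → ℤˣ, g (twist T H χ) = 𝔼 η, g η := fun H =>
    Fintype.expect_equiv (Equiv.mulRight fun q => charSign χ (H q)) _ _ fun T => rfl
  simp only [h]
  exact Fintype.expect_const _

/-! ### Random families of characters -/

/-- The members of a random family of characters outside of a small set `D` are linearly
independent. -/
theorem exists_dependent_set (k n : ℕ) :
    ∃ D : (Fin n → Alphabet k) → Finset (Fin n),
      (∀ χ, LinearIndepOn (ZMod 2) χ {i | i ∉ D χ}) ∧
      ∀ (M : ℕ) (y : ℝ), n ≤ M + 1 → 0 ≤ y →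
        𝔼 χ, y ^ (D χ).card ≤ (1 + y * (2 ^ M / 2 ^ k)) ^ n := by
  classical
  induction n with
  | zero => exact ⟨fun _ => ∅, fun χ => by
      convert linearIndepOn_empty (ZMod 2) χ
      exact Subsingleton.elim _ _, by simp⟩
  | succ n ih =>
    obtain ⟨D, hD, hcard⟩ := ih
    have hspan : ∀ χ : Fin n → Alphabet k,
        ((Finset.univ.filter fun a => a ∈ Submodule.span (ZMod 2) (Set.range χ)).card : ℝ) ≤
          2 ^ n := by
      intro χ
      have h1 : (Finset.univ.filter fun a => a ∈ Submodule.span (ZMod 2) (Set.range χ)).card =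
          Fintype.card (Submodule.span (ZMod 2) (Set.range χ)) :=
        (Fintype.card_subtype _).symm
      rw [h1, Module.card_eq_pow_finrank (K := ZMod 2), ZMod.card]
      have h2 := finrank_range_le_card (R := ZMod 2) χ
      rw [Fintype.card_fin] at h2
      exact_mod_cast Nat.pow_le_pow_right two_pos h2
    -- `D` collects the indices whose character lies in the span of the later ones. Given those,
    -- this has probability at most the size of the span over `2 ^ k`.
    refine ⟨fun χ => if χ 0 ∈ Submodule.span (ZMod 2) (Set.range (Fin.tail χ)) then
      insert 0 ((D (Fin.tail χ)).map (Fin.succEmb n)) else (D (Fin.tail χ)).map (Fin.succEmb n),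
      fun χ => ?_, fun M y hM hy => ?_⟩
    · have htail : LinearIndepOn (ZMod 2) χ (Fin.succ '' {i | i ∉ D (Fin.tail χ)}) :=
        LinearIndepOn.image_of_comp _ _ (hD (Fin.tail χ))
      by_cases h0 : χ 0 ∈ Submodule.span (ZMod 2) (Set.range (Fin.tail χ))
      · convert htail using 1
        ext i
        refine Fin.cases ?_ (fun j => ?_) i <;> simp [h0]
      · have hset : {i | i ∉ (if χ 0 ∈ Submodule.span (ZMod 2) (Set.range (Fin.tail χ)) then
            insert 0 ((D (Fin.tail χ)).map (Fin.succEmb n)) else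
              (D (Fin.tail χ)).map (Fin.succEmb n))} =
            insert 0 (Fin.succ '' {i | i ∉ D (Fin.tail χ)}) := by
          ext i
          refine Fin.cases ?_ (fun j => ?_) i <;> simp [h0]
        rw [hset, linearIndepOn_insert (by simp)]
        refine ⟨htail, fun h => h0 (Submodule.span_mono ?_ h)⟩
        rintro _ ⟨_, ⟨i, -, rfl⟩, rfl⟩
        exact ⟨i, rfl⟩
    · have hq : (0 : ℝ) ≤ 1 + y * (2 ^ M / 2 ^ k) := by positivity
      -- Only the `n` tail members span, so a family of `n + 1` needs just `n ≤ M`.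
      have hle : (2 : ℝ) ^ n ≤ 2 ^ M := pow_le_pow_right₀ one_le_two (by omega)
      rw [← Fintype.expect_equiv (Fin.consEquiv fun _ : Fin (n + 1) => Alphabet k) _ _
        fun _ => rfl, ← Finset.univ_product_univ, Finset.expect_product, Finset.expect_comm]
      have hstep : ∀ χ : Fin n → Alphabet k, 𝔼 a : Alphabet k,
          y ^ (if (Fin.cons a χ : Fin (n + 1) → Alphabet k) 0 ∈ Submodule.span (ZMod 2)
            (Set.range (Fin.tail (Fin.cons a χ : Fin (n + 1) → Alphabet k))) then
            insert 0 ((D (Fin.tail (Fin.cons a χ : Fin (n + 1) → Alphabet k))).map (Fin.succEmb n))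
            else (D (Fin.tail (Fin.cons a χ : Fin (n + 1) → Alphabet k))).map
              (Fin.succEmb n)).card ≤ (1 + y * (2 ^ M / 2 ^ k)) * y ^ (D χ).card := by
        intro χ
        have hpt : ∀ a : Alphabet k,
            y ^ (if (Fin.cons a χ : Fin (n + 1) → Alphabet k) 0 ∈ Submodule.span (ZMod 2)
            (Set.range (Fin.tail (Fin.cons a χ : Fin (n + 1) → Alphabet k))) then
            insert 0 ((D (Fin.tail (Fin.cons a χ : Fin (n + 1) → Alphabet k))).map (Fin.succEmb n))
            else (D (Fin.tail (Fin.cons a χ : Fin (n + 1) → Alphabet k))).map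
              (Fin.succEmb n)).card ≤
            (1 + y * (if a ∈ Submodule.span (ZMod 2) (Set.range χ) then 1 else 0)) *
              y ^ (D χ).card := by
          intro a
          simp only [Fin.cons_zero, Fin.tail_cons]
          split_ifs with ha
          · rw [Finset.card_insert_of_notMem (by simp), Finset.card_map, pow_succ]
            nlinarith [pow_nonneg hy (D χ).card]
          · simp
        refine (Finset.expect_le_expect fun a _ => hpt a).trans ?_
        rw [← Finset.expect_mul, Finset.expect_add_distrib, ← Finset.mul_expect,
          Fintype.expect_const, Fintype.expect_eq_sum_div_card]
        gcongr
        · simpa using (hspan χ).trans hle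
        · simp
      refine (Finset.expect_le_expect fun χ _ => hstep χ).trans ?_
      rw [← Finset.mul_expect, pow_succ']
      gcongr
      exact hcard M y (by omega) hy

/-! ### Moments of the square function -/

section SquareFunction

variable {c k : ℕ} (w : Key c (Alphabet k) → ℝ)

theorem expect_chaos_twist_pow_le {N : ℕ} (hN : N ≠ 0) (χ : Alphabet k) :
    𝔼 z : (Fin c × Alphabet k → ℤˣ) × (Fin c × Alphabet k → Alphabet k),
      chaos w (twist z.1 z.2 χ) ^ (2 * N) ≤
        ((2 * Real.exp 1 * N) ^ c * ∑ x, w x ^ 2) ^ N := by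
  rw [expect_twist χ fun η => chaos w η ^ (2 * N), mul_pow, ← pow_mul]
  exact expect_chaos_pow_le w hN

/-- For each fixed sign table the chaoses off `D` are independent in `H`, so the expectation
factorises into moments of order `4m`; the base does not involve `n`. -/
theorem expect_prod_independent_le {n m : ℕ} (hm : m ≠ 0) {χ : Fin n → Alphabet k}
    {D : Finset (Fin n)} (hD : LinearIndepOn (ZMod 2) χ {i | i ∉ D}) :
    𝔼 z : (Fin c × Alphabet k → ℤˣ) × (Fin c × Alphabet k → Alphabet k),
      ∏ i ∈ Dᶜ, chaos w (twist z.1 z.2 (χ i)) ^ (4 * m) ≤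
        ((4 * Real.exp 1 * m) ^ c * ∑ x, w x ^ 2) ^ (2 * m * Dᶜ.card) := by
  have hprod : ∀ f : Fin n → ℝ, ∏ i ∈ Dᶜ, f i = ∏ i : {i // i ∉ D}, f i := fun f =>
    (Finset.prod_subtype _ (by simp) _)
  have hN : 2 * m ≠ 0 := by omega
  have hmom : 𝔼 η, chaos w η ^ (4 * m) ≤
      ((4 * Real.exp 1 * m) ^ c * ∑ x, w x ^ 2) ^ (2 * m) := by
    have h := expect_chaos_pow_le w hN
    rw [← mul_assoc] at h
    refine h.trans (le_of_eq ?_)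
    have e : 2 * Real.exp 1 * ((2 * m : ℕ) : ℝ) = 4 * Real.exp 1 * m := by push_cast; ring
    rw [e, mul_pow _ (∑ x, w x ^ 2), ← pow_mul]
  have hnn : 0 ≤ 𝔼 η, chaos w η ^ (4 * m) := Finset.expect_nonneg fun η _ =>
    Even.pow_nonneg ⟨2 * m, by ring⟩ _
  rw [← Finset.univ_product_univ, Finset.expect_product]
  have hT : ∀ T : Fin c × Alphabet k → ℤˣ, 𝔼 H : Fin c × Alphabet k → Alphabet k,
      ∏ i ∈ Dᶜ, chaos w (twist T H (χ i)) ^ (4 * m) =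
        (𝔼 η, chaos w η ^ (4 * m)) ^ Dᶜ.card := by
    intro T
    simp only [hprod]
    rw [expect_prod_twist (χ := fun i : {i // i ∉ D} => χ i) hD T fun η => chaos w η ^ (4 * m)]
    rw [Finset.prod_const, Finset.card_univ, Fintype.card_subtype, Finset.compl_eq_univ_sdiff]
    congr 2
    ext i; simp
  simp only [hT, pow_mul _ (2 * m)]
  rw [Fintype.expect_const]
  exact pow_le_pow_left₀ hnn hmom _

/-- No joint law is available on `D`, so AM-GM raises the order to `4m * D.card`; hypercontractivity
turns this into the extra `D.card ^ c ≤ n ^ c` per factor. -/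
theorem expect_prod_dependent_le {n m : ℕ} (hm : m ≠ 0) (χ : Fin n → Alphabet k)
    (D : Finset (Fin n)) :
    𝔼 z : (Fin c × Alphabet k → ℤˣ) × (Fin c × Alphabet k → Alphabet k),
      ∏ i ∈ D, chaos w (twist z.1 z.2 (χ i)) ^ (4 * m) ≤
        ((4 * Real.exp 1 * m) ^ c * (n : ℝ) ^ c * ∑ x, w x ^ 2) ^ (2 * m * D.card) := by
  rcases D.eq_empty_or_nonempty with rfl | hne
  · simp
  have hc : D.card ≠ 0 := hne.card_pos.ne'
  have hS : 0 ≤ ∑ x, w x ^ 2 := Finset.sum_nonneg fun x _ => sq_nonneg _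
  have hcn : (D.card : ℝ) ≤ n := by
    exact_mod_cast (Finset.card_le_univ D).trans_eq (Fintype.card_fin n)
  refine expect_prod_le_of_moment D hne (fun i z => Even.pow_nonneg ⟨2 * m, by ring⟩ _)
    fun i => ?_
  have h := expect_chaos_twist_pow_le w (N := 2 * m * D.card)
    (mul_ne_zero (by omega) hc) (χ i)
  simp only [← pow_mul]
  have he : 2 * (2 * m * D.card) = 4 * m * D.card := by ring
  rw [he] at h
  refine h.trans ?_
  rw [← mul_pow (4 * Real.exp 1 * m) (n : ℝ) c]
  have h2 : 2 * Real.exp 1 * ((2 * m * D.card : ℕ) : ℝ) ≤ 4 * Real.exp 1 * m * n := by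
    push_cast
    calc 2 * Real.exp 1 * (2 * m * D.card) = 4 * Real.exp 1 * m * D.card := by ring
      _ ≤ _ := by gcongr
  gcongr

/-- Cauchy-Schwarz separates `D` from its complement, which is why both preceding bounds concern the
exponent `4m` instead of `2m`. -/
theorem expect_prod_twist_pow_le {n m : ℕ} (hm : m ≠ 0) {χ : Fin n → Alphabet k}
    {D : Finset (Fin n)} (hD : LinearIndepOn (ZMod 2) χ {i | i ∉ D}) :
    𝔼 z : (Fin c × Alphabet k → ℤˣ) × (Fin c × Alphabet k → Alphabet k),
      (∏ i, chaos w (twist z.1 z.2 (χ i)) ^ 2) ^ m ≤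
        (((4 * Real.exp 1 * m) ^ c * ∑ x, w x ^ 2) ^ n * ((n : ℝ) ^ c) ^ D.card) ^ m := by
  classical
  set C := (4 * Real.exp 1 * (m : ℝ)) ^ c with hC
  set S := ∑ x, w x ^ 2 with hSdef
  have hC0 : 0 ≤ C := by positivity
  have hS : 0 ≤ S := Finset.sum_nonneg fun x _ => sq_nonneg _
  have hcs := Finset.expect_mul_sq_le_sq_mul_sq Finset.univ
    (fun z : (Fin c × Alphabet k → ℤˣ) × (Fin c × Alphabet k → Alphabet k) =>
      ∏ i ∈ Dᶜ, chaos w (twist z.1 z.2 (χ i)) ^ (2 * m))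
    (fun z => ∏ i ∈ D, chaos w (twist z.1 z.2 (χ i)) ^ (2 * m))
  have e4 : 2 * m * 2 = 4 * m := by ring
  simp only [← Finset.prod_pow, ← pow_mul, Finset.prod_compl_mul_prod, e4] at hcs ⊢
  refine (pow_le_pow_iff_left₀ (Finset.expect_nonneg fun z _ => Finset.prod_nonneg fun i _ =>
    (even_two_mul m).pow_nonneg _) (by positivity) two_ne_zero).1 ?_
  refine hcs.trans ?_
  refine (mul_le_mul (expect_prod_independent_le w hm hD) (expect_prod_dependent_le w hm χ D)
    (Finset.expect_nonneg fun z _ => Finset.prod_nonneg fun i _ =>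
      Even.pow_nonneg ⟨2 * m, by ring⟩ _) (by positivity)).trans (le_of_eq ?_)
  rw [← hC, ← hSdef]
  have hn : Dᶜ.card + D.card = n := by
    rw [Finset.card_compl_add_card, Fintype.card_fin]
  have e : C * (n : ℝ) ^ c * S = (C * S) * (n : ℝ) ^ c := by ring
  rw [e]
  generalize C * S = X
  rw [mul_pow X, ← mul_assoc, ← pow_add, ← mul_add, hn]
  ring

/-- The moments of the square function `𝔼 χ, P_χ ^ 2`. -/
theorem expect_square_function_pow_le {n m M : ℕ} (hm : m ≠ 0) (hn : n ≤ M + 1) :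
    𝔼 z : (Fin c × Alphabet k → ℤˣ) × (Fin c × Alphabet k → Alphabet k),
      (𝔼 χ, chaos w (twist z.1 z.2 χ) ^ 2) ^ (n * m) ≤
        (((4 * Real.exp 1 * m) ^ c * ∑ x, w x ^ 2) *
          (1 + (n : ℝ) ^ c * (2 ^ M / 2 ^ k))) ^ (n * m) := by
  obtain ⟨D, hD, hcard⟩ := exists_dependent_set k n
  have hS : 0 ≤ ∑ x, w x ^ 2 := Finset.sum_nonneg fun x _ => sq_nonneg _
  have hpow : ∀ z : (Fin c × Alphabet k → ℤˣ) × (Fin c × Alphabet k → Alphabet k),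
      (𝔼 χ, chaos w (twist z.1 z.2 χ) ^ 2) ^ n =
        𝔼 χ : Fin n → Alphabet k, ∏ i, chaos w (twist z.1 z.2 (χ i)) ^ 2 := by
    intro z
    rw [expect_prod_eq_prod_expect fun (_ : Fin n) χ => chaos w (twist z.1 z.2 χ) ^ 2]
    simp
  simp only [pow_mul, hpow]
  -- Minkowski at exponent `m` moves the average over tuples outside, so that each tuple is treated
  -- with its own `D χ`.
  refine (expect_expect_pow_le hm (fun χ z => Finset.prod_nonneg fun i _ => sq_nonneg _)
    (b := fun χ => ((4 * Real.exp 1 * m) ^ c * ∑ x, w x ^ 2) ^ n * ((n : ℝ) ^ c) ^ (D χ).card)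
    (fun χ => by positivity) fun χ => expect_prod_twist_pow_le w hm (hD χ)).trans ?_
  rw [← Finset.mul_expect, mul_pow (_ * _) _ n]
  have h := hcard M ((n : ℝ) ^ c) hn (by positivity)
  have h0 : 0 ≤ 𝔼 χ : Fin n → Alphabet k, ((n : ℝ) ^ c) ^ (D χ).card :=
    Finset.expect_nonneg fun χ _ => by positivity
  gcongr

/-- The even moments of a signed sum with one derived character. -/
theorem expect_one_derived_pow_le {n m M : ℕ} (hm : m ≠ 0) (hn : n ≤ M + 1) :
    𝔼 z : (Fin c × Alphabet k → ℤˣ) × (Fin c × Alphabet k → Alphabet k),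
      𝔼 t : Alphabet k → ℤˣ,
        (∑ x, w x * ((∏ i, z.1 (i, x i) : ℤˣ) : ℤ) * (t (∑ i, z.2 (i, x i)) : ℤ)) ^
          (2 * (n * m)) ≤
        (2 * Real.exp 1 * (n * m : ℕ) * ((4 * Real.exp 1 * m) ^ c *
          (1 + (n : ℝ) ^ c * (2 ^ M / 2 ^ k))) * ∑ x, w x ^ 2) ^ (n * m) := by
  have hk : ∀ z : (Fin c × Alphabet k → ℤˣ) × (Fin c × Alphabet k → Alphabet k),
      𝔼 t : Alphabet k → ℤˣ,
        (∑ x, w x * ((∏ i, z.1 (i, x i) : ℤˣ) : ℤ) * (t (∑ i, z.2 (i, x i)) : ℤ)) ^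
          (2 * (n * m)) ≤ (2 * Real.exp 1 * (n * m : ℕ)) ^ (n * m) *
          (𝔼 χ, chaos w (twist z.1 z.2 χ) ^ 2) ^ (n * m) := by
    intro z
    refine (khintchine_hash (fun x => w x * ((∏ i, z.1 (i, x i) : ℤˣ) : ℤ))
      (fun x : Key c (Alphabet k) => ∑ i, z.2 (i, x i)) (n * m)).trans (le_of_eq ?_)
    congr 2
    refine Finset.expect_congr rfl fun χ _ => ?_
    congr 1
    refine Finset.sum_congr rfl fun x _ => ?_
    rw [charSign_sum, mul_assoc, ← Int.cast_mul, ← Units.val_mul, ← Finset.prod_mul_distrib]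
    rfl
  refine (Finset.expect_le_expect fun z _ => hk z).trans ?_
  rw [← Finset.mul_expect]
  refine (mul_le_mul_of_nonneg_left (expect_square_function_pow_le w hm hn)
    (by positivity)).trans (le_of_eq ?_)
  rw [← mul_pow]
  congr 1; ring

end SquareFunction

/-! ### Reduction to one derived character -/

/-- The value at `x` of the simple tabulation function with table `T`. -/
def tabulate {c : ℕ} {A R : Type} [AddCommMonoid R] (T : Fin c × A → R) (x : Key c A) : R :=
  ∑ i, T (i, x i)

/-- The value at `x` of the simple tabulation sign function with table `T`. -/
def tabulateSign {c : ℕ} {A : Type} (T : Fin c × A → ℤˣ) (x : Key c A) : ℤˣ :=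
  ∏ i, T (i, x i)

/-- The even moments of a signed sum with any positive number of derived characters. -/
theorem expect_mixed_pow_le {c k d n m M : ℕ} (w : Key c (Alphabet k) → ℝ) (hm : m ≠ 0)
    (hn : n ≤ M + 1) :
    𝔼 T₁ : Fin c × Alphabet k → ℤˣ, 𝔼 H : Fin c × Alphabet k → Key (d + 1) (Alphabet k),
      𝔼 T₃ : Fin (d + 1) × Alphabet k → ℤˣ,
        (∑ x, w x * ((tabulateSign T₁ x * tabulateSign T₃ (tabulate H x) : ℤˣ) : ℤ)) ^
          (2 * (n * m)) ≤
        (2 * Real.exp 1 * (n * m : ℕ) * ((4 * Real.exp 1 * m) ^ c *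
          (1 + (n : ℝ) ^ c * (2 ^ M / 2 ^ k))) * ∑ x, w x ^ 2) ^ (n * m) := by
  let e : (Fin c × Alphabet k → Alphabet k) × (Fin c × Alphabet k → Key d (Alphabet k)) ≃
      (Fin c × Alphabet k → Key (d + 1) (Alphabet k)) :=
    (Equiv.arrowProdEquivProdArrow _ _ _).symm.trans
      ((Equiv.refl _).arrowCongr (Fin.consEquiv fun _ => Alphabet k))
  set B := (2 * Real.exp 1 * (n * m : ℕ) * ((4 * Real.exp 1 * m) ^ c *
          (1 + (n : ℝ) ^ c * (2 ^ M / 2 ^ k))) * ∑ x, w x ^ 2) ^ (n * m) with hB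
  -- The other `d` derived characters contribute a sign for each key, absorbed into `w`.
  have hfix : ∀ (H : Fin c × Alphabet k → Key d (Alphabet k)) (T : Fin d × Alphabet k → ℤˣ),
      𝔼 T₁ : Fin c × Alphabet k → ℤˣ, 𝔼 H₀ : Fin c × Alphabet k → Alphabet k,
        𝔼 t : Alphabet k → ℤˣ,
        (∑ x, w x * ((tabulateSign T₁ x *
          tabulateSign (tableConsEquiv d (Alphabet k) ℤˣ (t, T)) (tabulate (e (H₀, H)) x) :
            ℤˣ) : ℤ)) ^ (2 * (n * m)) ≤ B := by
    intro H T
    have h := expect_one_derived_pow_le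
      (fun x => w x * ((tabulateSign T (tabulate H x) : ℤˣ) : ℤ)) hm hn
    rw [← Finset.univ_product_univ, Finset.expect_product] at h
    have hsq : ∀ x : Key c (Alphabet k),
        (w x * (((tabulateSign T (tabulate H x) : ℤˣ) : ℤ) : ℝ)) ^ 2 = w x ^ 2 := by
      intro x
      rcases Int.units_eq_one_or (tabulateSign T (tabulate H x)) with h | h <;> simp [h]
    simp only [hsq] at h
    refine le_trans (le_of_eq ?_) h
    refine Finset.expect_congr rfl fun T₁ _ => Finset.expect_congr rfl fun H₀ _ =>
      Finset.expect_congr rfl fun t _ => ?_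
    congr 1
    refine Finset.sum_congr rfl fun x _ => ?_
    have h0 : tabulate (e (H₀, H)) x 0 = ∑ i, H₀ (i, x i) := by
      simp only [tabulate, Finset.sum_apply]; rfl
    have hs : ∀ j : Fin d, tabulate (e (H₀, H)) x j.succ = tabulate H x j := by
      intro j; simp only [tabulate, Finset.sum_apply]; rfl
    have h3 : tabulateSign (tableConsEquiv d (Alphabet k) ℤˣ (t, T)) (tabulate (e (H₀, H)) x) =
        t (∑ i, H₀ (i, x i)) * tabulateSign T (tabulate H x) := by
      rw [tabulateSign, Fin.prod_univ_succ, tableConsEquiv_zero, h0]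
      simp only [tableConsEquiv_succ, hs]
      rfl
    rw [h3]
    simp only [tabulateSign, Units.val_mul, Int.cast_mul]
    ring
  have hH : ∀ f : (Fin c × Alphabet k → Key (d + 1) (Alphabet k)) → ℝ,
      𝔼 H, f H = 𝔼 H, 𝔼 H₀, f (e (H₀, H)) := by
    intro f
    rw [← Fintype.expect_equiv e (fun z => f (e z)) f fun _ => rfl, ← Finset.univ_product_univ,
      Finset.expect_product, Finset.expect_comm]
  have hT : ∀ f : (Fin (d + 1) × Alphabet k → ℤˣ) → ℝ,
      𝔼 T, f T = 𝔼 T, 𝔼 t, f (tableConsEquiv d (Alphabet k) ℤˣ (t, T)) := by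
    intro f
    rw [← Fintype.expect_equiv (tableConsEquiv d (Alphabet k) ℤˣ)
      (fun z => f (tableConsEquiv d (Alphabet k) ℤˣ z)) f fun _ => rfl, ← Finset.univ_product_univ,
      Finset.expect_product, Finset.expect_comm]
  simp only [hH, hT]
  rw [Finset.expect_comm]
  refine Finset.expect_le Finset.univ_nonempty fun H _ => ?_
  have hcomm : ∀ g : (Fin c × Alphabet k → ℤˣ) → (Fin c × Alphabet k → Alphabet k) →
      (Fin d × Alphabet k → ℤˣ) → ℝ,
      𝔼 T₁, 𝔼 H₀, 𝔼 T, g T₁ H₀ T = 𝔼 T, 𝔼 T₁, 𝔼 H₀, g T₁ H₀ T := by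
    intro g
    exact (Finset.expect_congr rfl fun T₁ _ => Finset.expect_comm _ _ _).trans
      (Finset.expect_comm _ _ _)
  rw [hcomm]
  exact Finset.expect_le Finset.univ_nonempty fun T _ => hfix H T

/-! ### From random tables to finite averages -/

section Transfer

variable {Ω : Type*} [MeasurableSpace Ω] {μ : Measure Ω}

theorem IsUniformTable.aemeasurable {c : ℕ} {A R : Type} [Fintype A] [MeasurableSpace R]
    {T : Fin c × A → Ω → R} (hT : IsUniformTable μ T) : AEMeasurable (fun ω q => T q ω) μ :=
  aemeasurable_pi_lambda _ fun q => (hT.uniform q).aemeasurable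

variable [IsProbabilityMeasure μ]

theorem IsUniformTable.integral_eq_expect {c : ℕ} {A R : Type} [Fintype A] [DecidableEq A]
    [Fintype R] [MeasurableSpace R] [MeasurableSingletonClass R]
    {T : Fin c × A → Ω → R} (hT : IsUniformTable μ T) (f : (Fin c × A → R) → ℝ) :
    ∫ ω, f (fun q => T q ω) ∂μ = 𝔼 τ, f τ := by
  have hmap := (iIndepFun_iff_map_fun_eq_pi_map fun q => (hT.uniform q).aemeasurable).1 hT.indep
  simp only [fun q => (hT.uniform q).map_eq] at hmap
  rw [← integral_map hT.aemeasurable (f := f) (measurable_of_finite f).aestronglyMeasurable, hmap]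
  have : IsProbabilityMeasure (Measure.pi fun _ : Fin c × A => (uniformOn Set.univ : Measure R)) :=
    hmap ▸ Measure.isProbabilityMeasure_map hT.aemeasurable
  rw [integral_fintype Integrable.of_finite, Fintype.expect_eq_sum_div_card, Finset.sum_div]
  refine Finset.sum_congr rfl fun τ _ => ?_
  have hr : (Measure.pi fun _ : Fin c × A => (uniformOn Set.univ : Measure R)).real {τ} =
      (Fintype.card (Fin c × A → R) : ℝ)⁻¹ := by
    rw [measureReal_def, ← Set.univ_pi_singleton]
    -- `R` may be empty, in which case the uniform measure is zero and not a probability measure.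
    have : SigmaFinite (uniformOn Set.univ : Measure R) := by
      rcases isEmpty_or_nonempty R with h | h
      · rw [Measure.eq_zero_of_isEmpty (uniformOn Set.univ : Measure R)]
        infer_instance
      · have := isProbabilityMeasure_uniformOn (Ω := R) Set.finite_univ Set.univ_nonempty
        infer_instance
    rw [Measure.pi_pi]
    simp only [uniformOn_univ, Measure.count_singleton]
    simp
  rw [hr, smul_eq_mul, div_eq_inv_mul]

/-- Fubini on the product law: one of two independent variables may be resampled, so the tables can
be averaged out one at a time. -/
theorem IndepFun.integral_eq_integral_integral {X Y : Type*} [Finite X] [Finite Y]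
    [MeasurableSpace X] [MeasurableSpace Y] [MeasurableSingletonClass X]
    [MeasurableSingletonClass Y] {U : Ω → X} {V : Ω → Y} (hU : AEMeasurable U μ)
    (hV : AEMeasurable V μ) (h : IndepFun U V μ) (f : X → Y → ℝ) :
    ∫ ω, f (U ω) (V ω) ∂μ = ∫ ω, ∫ ω', f (U ω) (V ω') ∂μ ∂μ := by
  have hprod := (indepFun_iff_map_prod_eq_prod_map_map hU hV).1 h
  have := Measure.isProbabilityMeasure_map hU
  have := Measure.isProbabilityMeasure_map hV
  calc ∫ ω, f (U ω) (V ω) ∂μ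
      = ∫ z, f z.1 z.2 ∂(μ.map fun ω => (U ω, V ω)) :=
        (integral_map (hU.prodMk hV) (f := fun z : X × Y => f z.1 z.2)
          (measurable_of_finite _).aestronglyMeasurable).symm
    _ = ∫ x, ∫ y, f x y ∂(μ.map V) ∂(μ.map U) := by
        rw [hprod, integral_prod _ Integrable.of_finite]
    _ = ∫ ω, ∫ y, f (U ω) y ∂(μ.map V) ∂μ :=
        integral_map hU (measurable_of_finite _).aestronglyMeasurable
    _ = _ := by
        refine integral_congr_ae (Filter.Eventually.of_forall fun ω => ?_)
        exact integral_map hV (measurable_of_finite _).aestronglyMeasurable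

theorem integrable_comp_of_finite {X : Type*} [Finite X] [MeasurableSpace X]
    [MeasurableSingletonClass X] {U : Ω → X} (hU : AEMeasurable U μ) (f : X → ℝ) :
    Integrable (fun ω => f (U ω)) μ := by
  have := Measure.isProbabilityMeasure_map hU
  exact (integrable_map_measure (measurable_of_finite f).aestronglyMeasurable hU).1
    Integrable.of_finite

/-- A mixed tabulation sign function is a.e. measurable, and the expectation of a functional of it
is an average over three tables. -/
theorem IsMixedTabulationSign.integral_eq_expect {c k d : ℕ} {ε : Ω → Key c (Alphabet k) → ℤˣ}
    (hε : IsMixedTabulationSign μ d ε) :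
    AEMeasurable ε μ ∧ ∀ f : (Key c (Alphabet k) → ℤˣ) → ℝ,
      ∫ ω, f (ε ω) ∂μ = 𝔼 T₁ : Fin c × Alphabet k → ℤˣ,
        𝔼 H : Fin c × Alphabet k → Key d (Alphabet k), 𝔼 T₃ : Fin d × Alphabet k → ℤˣ,
          f fun x => tabulateSign T₁ x * tabulateSign T₃ (tabulate H x) := by
  obtain ⟨ε₁, h₂, ε₃, ⟨T₁, hT₁, e₁⟩, ⟨H, hH, e₂⟩, ⟨T₃, hT₃, e₃⟩, hi, hi', e⟩ := hε
  obtain rfl : ε₁ = fun ω => tabulateSign fun q => T₁ q ω := by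
    funext ω x; exact e₁ ω x
  obtain rfl : h₂ = fun ω => tabulate fun q => H q ω := by
    funext ω x; exact e₂ ω x
  obtain rfl : ε₃ = fun ω => tabulateSign fun q => T₃ q ω := by
    funext ω x; exact e₃ ω x
  obtain rfl : ε = fun ω x => tabulateSign (fun q => T₁ q ω) x *
      tabulateSign (fun q => T₃ q ω) (tabulate (fun q => H q ω) x) := by
    funext ω x; exact e ω x
  have m₁ : AEMeasurable (fun ω => tabulateSign fun q => T₁ q ω) μ :=
    (measurable_of_finite tabulateSign).comp_aemeasurable hT₁.aemeasurable
  have m₂ : AEMeasurable (fun ω => tabulate fun q => H q ω) μ :=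
    (measurable_of_finite tabulate).comp_aemeasurable hH.aemeasurable
  have m₃ : AEMeasurable (fun ω => tabulateSign fun q => T₃ q ω) μ :=
    (measurable_of_finite tabulateSign).comp_aemeasurable hT₃.aemeasurable
  refine ⟨(measurable_of_finite fun z : ((Key c (Alphabet k) → ℤˣ) ×
    (Key c (Alphabet k) → Key d (Alphabet k))) × (Key d (Alphabet k) → ℤˣ) =>
      fun x => z.1.1 x * z.2 (z.1.2 x)).comp_aemeasurable ((m₁.prodMk m₂).prodMk m₃), fun f => ?_⟩
  -- `ε₃` is split off first, being independent of the pair `(ε₁, h₂)`; then `h₂` is separated from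
  -- `ε₁`.
  calc _ = ∫ ω, ∫ ω', f (fun x => tabulateSign (fun q => T₁ q ω) x *
        tabulateSign (fun q => T₃ q ω') (tabulate (fun q => H q ω) x)) ∂μ ∂μ :=
        IndepFun.integral_eq_integral_integral (m₁.prodMk m₂) m₃ hi'
          fun z s => f fun x => z.1 x * s (z.2 x)
    _ = ∫ ω, 𝔼 τ, f (fun x => tabulateSign (fun q => T₁ q ω) x *
        tabulateSign τ (tabulate (fun q => H q ω) x)) ∂μ := by
        refine integral_congr_ae (Filter.Eventually.of_forall fun ω => ?_)
        exact hT₃.integral_eq_expect fun τ => f fun x => tabulateSign (fun q => T₁ q ω) x *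
          tabulateSign τ (tabulate (fun q => H q ω) x)
    _ = ∫ ω, ∫ ω', 𝔼 τ, f (fun x => tabulateSign (fun q => T₁ q ω) x *
        tabulateSign τ (tabulate (fun q => H q ω') x)) ∂μ ∂μ :=
        IndepFun.integral_eq_integral_integral m₁ m₂ hi
          fun s h => 𝔼 τ, f fun x => s x * tabulateSign τ (h x)
    _ = ∫ ω, 𝔼 η, 𝔼 τ, f (fun x => tabulateSign (fun q => T₁ q ω) x *
        tabulateSign τ (tabulate η x)) ∂μ := by
        refine integral_congr_ae (Filter.Eventually.of_forall fun ω => ?_)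
        exact hH.integral_eq_expect fun η => 𝔼 τ, f fun x => tabulateSign (fun q => T₁ q ω) x *
          tabulateSign τ (tabulate η x)
    _ = _ := hT₁.integral_eq_expect fun σ => 𝔼 η, 𝔼 τ, f fun x => tabulateSign σ x *
          tabulateSign τ (tabulate η x)

/-- A bound for the `q`-th moment, `q ≥ p`, bounds the `p`-norm. -/
theorem pNorm_le_of_integral_pow_le {X : Ω → ℝ} {p B : ℝ} {q : ℕ} (hp : 0 < p) (hpq : p ≤ q)
    (hq : Even q) (hB : 0 ≤ B) (hXp : Integrable (fun ω => |X ω| ^ p) μ)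
    (hXq : Integrable (fun ω => X ω ^ q) μ) (h : ∫ ω, X ω ^ q ∂μ ≤ B ^ q) :
    pNorm μ X p ≤ B := by
  have hq0 : (0 : ℝ) < q := hp.trans_le hpq
  have hpow : ∀ ω, (|X ω| ^ p) ^ ((q : ℝ) / p) = X ω ^ q := by
    intro ω
    rw [← Real.rpow_mul (abs_nonneg _), mul_div_cancel₀ _ hp.ne', Real.rpow_natCast,
      hq.pow_abs]
  have hI : 0 ≤ ∫ ω, |X ω| ^ p ∂μ := integral_nonneg fun ω => by positivity
  -- Jensen for `t ↦ t ^ (q / p)`.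
  have hJ := (convexOn_rpow ((one_le_div hp).2 hpq)).map_integral_le
    (Real.continuous_rpow_const (by positivity)).continuousOn isClosed_Ici
    (Filter.Eventually.of_forall fun ω => Set.mem_Ici.2 (by positivity : 0 ≤ |X ω| ^ p)) hXp
    (by simpa only [Function.comp_def, hpow] using hXq)
  simp only [hpow] at hJ
  have h1 := hJ.trans h
  have h2 := Real.rpow_le_rpow (by positivity) h1 (by positivity : 0 ≤ (q : ℝ)⁻¹)
  rw [← Real.rpow_mul hI, Real.pow_rpow_inv_natCast hB (by exact_mod_cast hq0.ne')] at h2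
  rw [pNorm]
  convert h2 using 2
  field_simp

end Transfer

/-! ### The choice of the parameters -/

/-- Raise `t ≤ exp t` at `t = n / (2c)` to the power `c`, and use `exp (1/2) ≤ 2`. -/
theorem pow_le_two_mul_pow_mul_two_pow (n : ℕ) {c : ℕ} (hc : 1 ≤ c) :
    (n : ℝ) ^ c ≤ (2 * c) ^ c * 2 ^ n := by
  have hc' : (0 : ℝ) < c := by exact_mod_cast hc
  have h1 : (n : ℝ) / (2 * c) ≤ Real.exp (n / (2 * c)) := by
    have := Real.add_one_le_exp ((n : ℝ) / (2 * c)); linarith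
  have h2 : ((n : ℝ) / (2 * c)) ^ c ≤ 2 ^ n := by
    calc ((n : ℝ) / (2 * c)) ^ c ≤ Real.exp (n / (2 * c)) ^ c := by gcongr
      _ = Real.exp (1 / 2) ^ n := by
          rw [← Real.exp_nat_mul, ← Real.exp_nat_mul]; congr 1; field_simp
      _ ≤ 2 ^ n := by
          gcongr
          rw [← Real.le_log_iff_exp_le two_pos]
          linarith [Real.log_two_gt_d9]
  rw [div_pow, div_le_iff₀ (by positivity)] at h2
  linarith

/-- The target order `⌈p/2⌉` is reached as `n * m`, with `n` capped at `(k + 1) / 2` so that random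
`n`-tuples are mostly independent. Below the cap `m = 1`; above it `m` is of order at most `p / k`,
hence of order at most `γ_p`. -/
theorem exists_block_sizes {p : ℝ} (hp : 2 ≤ p) {k : ℕ} (hk : 1 ≤ k) :
    ∃ n m : ℕ, n ≠ 0 ∧ m ≠ 0 ∧ 2 * n ≤ k + 1 ∧ p ≤ 2 * (n * m : ℕ) ∧ ((n * m : ℕ) : ℝ) ≤ 2 * p ∧
      (m : ℝ) ≤ 4 * gammaFactor (Fintype.card (Alphabet k)) p := by
  set N := ⌈p / 2⌉₊ with hN
  have h1 : p / 2 ≤ N := Nat.le_ceil _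
  have h2 : (N : ℝ) < p / 2 + 1 := Nat.ceil_lt_add_one (by linarith)
  have hN0 : N ≠ 0 := by
    intro h; rw [h] at h1; norm_num at h1; linarith
  have hγ : 1 ≤ gammaFactor (Fintype.card (Alphabet k)) p := le_max_left _ _
  by_cases hle : N ≤ (k + 1) / 2
  · refine ⟨N, 1, hN0, one_ne_zero, by omega, ?_, ?_, ?_⟩
    · rw [mul_one]; linarith
    · rw [mul_one]; linarith
    · rw [Nat.cast_one]; linarith
  · have hK0 : 0 < (k + 1) / 2 := by omega
    have hKk : k ≤ 2 * ((k + 1) / 2) := by omega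
    set K := (k + 1) / 2 with hK
    -- `m = ⌈N / K⌉`; rounding up at most doubles `N` because `K < N`.
    have hd1 : N ≤ K * ((N + K - 1) / K) := by
      have := Nat.lt_mul_div_succ (N + K - 1 - K) hK0
      have e : (N + K - 1) / K = (N + K - 1 - K) / K + 1 := by
        rw [Nat.div_eq_sub_div hK0 (by omega)]
      rw [e]; omega
    have hd2 : K * ((N + K - 1) / K) ≤ 2 * N := (Nat.mul_div_le _ _).trans (by omega)
    generalize (N + K - 1) / K = m at hd1 hd2
    have hd1' : (N : ℝ) ≤ (K * m : ℕ) := by exact_mod_cast hd1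
    have hd2' : ((K * m : ℕ) : ℝ) ≤ 2 * N := by exact_mod_cast hd2
    refine ⟨K, m, hK0.ne', ?_, by omega, by linarith, by linarith, ?_⟩
    · rintro rfl; simp at hd1; exact hN0 hd1
    · have hkr : (1 : ℝ) ≤ k := by exact_mod_cast hk
      have hlog : Real.log (Fintype.card (Alphabet k) : ℝ) = k * Real.log 2 := by
        simp [ZMod.card]
      have hlog2 : Real.log 2 ≤ 1 := by linarith [Real.log_two_lt_d9]
      have hlog0 : 0 < Real.log 2 := Real.log_pos one_lt_two
      have hg : p / (k * Real.log 2) ≤ gammaFactor (Fintype.card (Alphabet k)) p := by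
        rw [← hlog]; exact le_max_right _ _
      have hg' : p / k ≤ p / (k * Real.log 2) := by
        apply div_le_div_of_nonneg_left (by linarith) (by positivity)
        nlinarith
      have hKr : (k : ℝ) ≤ 2 * K := by exact_mod_cast hKk
      have hm : (m : ℝ) ≤ 4 * (p / k) := by
        rw [mul_div_assoc', le_div_iff₀ (by linarith)]
        push_cast at hd2'
        nlinarith [(Nat.cast_nonneg m : (0 : ℝ) ≤ m)]
      linarith

theorem constant_le {c k n m : ℕ} {p γ S : ℝ} (hc : 1 ≤ c) (hp : 2 ≤ p) (hγ : 1 ≤ γ) (hS : 0 ≤ S)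
    (hn : n ≠ 0) (hnk : 2 * n ≤ k + 1) (hnm : ((n * m : ℕ) : ℝ) ≤ 2 * p) (hm : (m : ℝ) ≤ 4 * γ) :
    2 * Real.exp 1 * (n * m : ℕ) * ((4 * Real.exp 1 * m) ^ c *
          (1 + (n : ℝ) ^ c * (2 ^ (n - 1) / 2 ^ k))) * S ≤
      Real.exp 1 * ((1000 * c) ^ c) ^ 2 * p * γ ^ c * S := by
  have hc' : (1 : ℝ) ≤ c := by exact_mod_cast hc
  -- `2n - 1 ≤ k` leaves a spare factor `2 ^ n` to absorb `n ^ c`.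
  have hpow : (n : ℝ) ^ c * (2 ^ (n - 1) / 2 ^ k) ≤ (2 * c) ^ c := by
    rw [mul_div_assoc', div_le_iff₀ (by positivity)]
    calc (n : ℝ) ^ c * 2 ^ (n - 1) ≤ ((2 * c) ^ c * 2 ^ n) * 2 ^ (n - 1) := by
          gcongr; exact pow_le_two_mul_pow_mul_two_pow n hc
      _ = (2 * c) ^ c * 2 ^ (n + (n - 1)) := by rw [mul_assoc, ← pow_add]
      _ ≤ (2 * c) ^ c * 2 ^ k := by
          gcongr
          · exact one_le_two
          · omega
  have h1 : (1 : ℝ) ≤ (2 * c) ^ c := one_le_pow₀ (by linarith)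
  have he : Real.exp 1 ≤ 3 := by linarith [Real.exp_one_lt_d9]
  have h8 : (8 : ℝ) ≤ 8 ^ c := le_self_pow₀ (by norm_num) (by omega)
  have hbig : (1 : ℝ) ≤ (1000 * c) ^ c := one_le_pow₀ (by linarith)
  calc 2 * Real.exp 1 * (n * m : ℕ) * ((4 * Real.exp 1 * m) ^ c *
          (1 + (n : ℝ) ^ c * (2 ^ (n - 1) / 2 ^ k))) * S
      ≤ 2 * Real.exp 1 * (2 * p) * ((4 * 3 * (4 * γ)) ^ c * ((2 * c) ^ c + (2 * c) ^ c)) * S := by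
        gcongr
    _ = Real.exp 1 * (8 * (96 * c) ^ c) * p * γ ^ c * S := by
        have : (96 * (c : ℝ)) ^ c = 48 ^ c * (2 * c) ^ c := by rw [← mul_pow]; congr 1; ring
        have h' : (4 * 3 * (4 * γ)) ^ c = 48 ^ c * γ ^ c := by rw [← mul_pow]; congr 1; ring
        rw [this, h']; ring
    _ ≤ Real.exp 1 * ((1000 * c) ^ c) ^ 2 * p * γ ^ c * S := by
        gcongr
        -- `8 ≤ 8 ^ c` gives base `768c`, rounded up to `1000c`; the square is slack, since the
        -- first power already suffices.
        calc 8 * (96 * (c : ℝ)) ^ c ≤ 8 ^ c * (96 * c) ^ c := by gcongr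
          _ = (768 * c) ^ c := by rw [← mul_pow]; congr 1; ring
          _ ≤ (1000 * c) ^ c := by gcongr; norm_num
          _ ≤ ((1000 * c) ^ c) ^ 2 := le_self_pow₀ hbig two_ne_zero

theorem mainTheorem10 :
    ∃ L : ℝ, 0 < L ∧
      ∀ (c d k : ℕ), 1 ≤ c → 1 ≤ d → 1 ≤ k →
      ∀ (Ω : Type*) [MeasurableSpace Ω] (μ : Measure Ω) [IsProbabilityMeasure μ]
        (ε : Ω → Key c (Alphabet k) → ℤˣ), IsMixedTabulationSign μ d ε →
      ∀ (w : Key c (Alphabet k) → ℝ) (p : ℝ), 2 ≤ p →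
        Integrable (fun ω => |∑ x, w x * ((ε ω x : ℤ) : ℝ)| ^ p) μ ∧
        pNorm μ (fun ω => ∑ x, w x * ((ε ω x : ℤ) : ℝ)) p ≤
          √(Real.exp 1) * (L * c) ^ c * √p *
            gammaFactor (Fintype.card (Alphabet k)) p ^ ((c : ℝ) / 2) * √(∑ x, w x ^ 2) := by
  refine ⟨1000, by norm_num, ?_⟩
  intro c d k hc hd hk Ω _ μ _ ε hε w p hp
  -- At least one derived character is needed for the Khintchine step.
  obtain ⟨d, rfl⟩ : ∃ d', d = d' + 1 := ⟨d - 1, by omega⟩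
  obtain ⟨hmeas, hint⟩ := hε.integral_eq_expect
  have hXp : Integrable (fun ω => |∑ x, w x * ((ε ω x : ℤ) : ℝ)| ^ p) μ :=
    integrable_comp_of_finite hmeas fun e => |∑ x, w x * ((e x : ℤ) : ℝ)| ^ p
  refine ⟨hXp, ?_⟩
  obtain ⟨n, m, hn, hm, hnk, hpN, hN, hmγ⟩ := exists_block_sizes hp hk
  have hγ : 1 ≤ gammaFactor (Fintype.card (Alphabet k)) p := le_max_left _ _
  have hS : 0 ≤ ∑ x, w x ^ 2 := Finset.sum_nonneg fun x _ => sq_nonneg _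
  refine pNorm_le_of_integral_pow_le (q := 2 * (n * m)) (by linarith)
    (by push_cast at hpN ⊢; exact hpN) (even_two_mul _) (by positivity) hXp
    (integrable_comp_of_finite hmeas fun e => (∑ x, w x * ((e x : ℤ) : ℝ)) ^ (2 * (n * m))) ?_
  rw [hint fun e => (∑ x, w x * ((e x : ℤ) : ℝ)) ^ (2 * (n * m))]
  refine (expect_mixed_pow_le w hm (M := n - 1) (by omega)).trans ?_
  rw [pow_mul _ 2 (n * m)]
  refine pow_le_pow_left₀ (by positivity) ?_ _
  refine (constant_le hc hp hγ hS hn hnk hN hmγ).trans (le_of_eq ?_)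
  have hγ2 : (gammaFactor (Fintype.card (Alphabet k)) p ^ ((c : ℝ) / 2)) ^ 2 =
      gammaFactor (Fintype.card (Alphabet k)) p ^ c := by
    rw [← Real.rpow_natCast, ← Real.rpow_mul (by linarith)]
    push_cast
    rw [div_mul_cancel₀ _ two_ne_zero, Real.rpow_natCast]
  simp only [mul_pow, hγ2]
  rw [Real.sq_sqrt (by positivity),
    Real.sq_sqrt (by linarith), Real.sq_sqrt hS]
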